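/- Let $N\ge 3$ and $\mathbb R^N_+=\{x\in\mathbb R^N: x_N>0\}$. Let $C_c^\infty(\overline{\mathbb R^N_+})$ be the space of restrictions to $\overline{\mathbb R^N_+}$ of functions in $C_c^\infty(\mathbb R^N)$, and let $\mathcal D^{1,2}(\overline{\mathbb R^N_+})$ be its completion with respect to the norm $\|u\|=\big(\int_{\mathbb R^N_+}|\nabla u|^2\,dx\big)^{1/2}$. For compact $K\subseteq\overline{\mathbb R^N_+}$ let $\mathcal D^{1,2}(\overline{\mathbb R^N_+}\setminus K)$ be the closure in $\mathcal D^{1,2}(\overline{\mathbb R^N_+})$ of the set of $u\in C_c^\infty(\overline{\mathbb R^N_+})$ that vanish in a neighbourhood of $K$ in $\overline{\mathbb R^N_+}$, and define the relative capacity $$\mathrm{cap}_{\overline{\mathbb R^N_+}}(K)=\inf\Big\{\int_{\mathbb R^N_+}|\nabla u|^2\,dx:\ u\in\mathcal D^{1,2}(\overline{\mathbb R^N_+}),\ u-\eta_K\in\mathcal D^{1,2}(\overline{\mathbb R^N_+}\setminus K)\Big\},$$ where $\eta_K\in C_c^\infty(\overline{\mathbb R^N_+})$ is any function equal to $1$ in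 a neighbourhood of $K$ in $\overline{\mathbb R^N_+}$ (the value does not depend on the choice of $\eta_K$). Then there exists a constant $C>0$, depending only on $N$, such that for every compact set $K\subseteq\partial\mathbb R^N_+$ $$\big(|K|_{N-1}\big)^{\frac{N-2}{N-1}}\le C\,\mathrm{cap}_{\overline{\mathbb R^N_+}}(K),$$ where $|\cdot|_{N-1}$ denotes the $(N-1)$-dimensional Lebesgue measure on $\partial\mathbb R^N_+\cong\mathbb R^{N-1}$. -/

import Mathlib

/-! Throughout, `d` stands for `N - 1`, so that the ambient space `ℝ^N` is
`EuclideanSpace ℝ (Fin (d + 1))` and its boundary hyperplane is a copy of `ℝ^(N-1)`, that is, of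
`EuclideanSpace ℝ (Fin d)`. -/

namespace HalfSpaceCapacity

open MeasureTheory Set
open scoped Gradient ContDiff

noncomputable section

/-- The ambient space `ℝ^N`, `N = d + 1`. -/
abbrev Ambient (d : ℕ) : Type := EuclideanSpace ℝ (Fin (d + 1))

/-- The open upper half-space `ℝ^N_+ = {x | x_N > 0}`. -/
def halfSpace (d : ℕ) : Set (Ambient d) := {x | 0 < x (Fin.last d)}

/-- The `(N-1)`-dimensional Lebesgue measure of a subset of `∂ℝ^N_+`, which is identified with
`ℝ^(N-1)` through `y ↦ (y, 0)`. -/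
def boundaryMeasure {d : ℕ} (K : Set (Ambient d)) : ℝ :=
  volume.real {y : EuclideanSpace ℝ (Fin d) |
    (WithLp.toLp 2 (Fin.snoc (α := fun _ => ℝ) (fun i => y i) 0) : Ambient d) ∈ K}

/-- `C_c^∞(ℝ^N)` as a subspace of the space of all functions. -/
def smoothCompact (d : ℕ) : Submodule ℝ (Ambient d → ℝ) where
  carrier := {u | ContDiff ℝ ∞ u ∧ HasCompactSupport u}
  add_mem' hu hv := ⟨hu.1.add hv.1, hu.2.add hv.2⟩
  zero_mem' := ⟨contDiff_const, HasCompactSupport.zero⟩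
  smul_mem' c _ hu := ⟨contDiff_const.smul hu.1, hu.2.smul_left (f := fun _ => c)⟩

/-- The space `C_c^∞` of the closed half-space, whose elements are the restrictions of functions in
`C_c^∞(ℝ^N)`. An element is represented by an extension to `ℝ^N`; the (semi)norm below only sees
the half-space, so that two extensions of one function are identified in the completion. -/
def TestFun (d : ℕ) : Type := smoothCompact d

instance (d : ℕ) : AddCommGroup (TestFun d) := inferInstanceAs (AddCommGroup (smoothCompact d))

instance (d : ℕ) : Module ℝ (TestFun d) := inferInstanceAs (Module ℝ (smoothCompact d))

instance (d : ℕ) : CoeFun (TestFun d) (fun _ => Ambient d → ℝ) := ⟨fun u => u.1⟩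

theorem TestFun.contDiff {d : ℕ} (u : TestFun d) : ContDiff ℝ ∞ u := u.2.1

theorem TestFun.hasCompactSupport {d : ℕ} (u : TestFun d) : HasCompactSupport u := u.2.2

theorem TestFun.add_apply {d : ℕ} (u v : TestFun d) (x : Ambient d) : (u + v) x = u x + v x := rfl

theorem TestFun.sub_apply {d : ℕ} (u v : TestFun d) (x : Ambient d) : (u - v) x = u x - v x := rfl

theorem TestFun.smul_apply {d : ℕ} (c : ℝ) (u : TestFun d) (x : Ambient d) :
    (c • u) x = c * u x := rfl

theorem TestFun.differentiableAt {d : ℕ} (u : TestFun d) (x : Ambient d) :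
    DifferentiableAt ℝ u x :=
  (u.contDiff.differentiable (by simp)) x

theorem TestFun.gradient_add {d : ℕ} (u v : TestFun d) (x : Ambient d) :
    ∇ (u + v : TestFun d) x = ∇ u x + ∇ v x := by
  have h : fderiv ℝ (u + v : TestFun d) x = fderiv ℝ u x + fderiv ℝ v x :=
    fderiv_add (u.differentiableAt x) (v.differentiableAt x)
  simp only [gradient, h, map_add]

theorem TestFun.gradient_smul {d : ℕ} (c : ℝ) (u : TestFun d) (x : Ambient d) :
    ∇ (c • u : TestFun d) x = c • ∇ u x := by
  have h : fderiv ℝ (c • u : TestFun d) x = c • fderiv ℝ u x :=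
    fderiv_const_smul (u.differentiableAt x) c
  simp [gradient, h]

theorem TestFun.continuous_gradient {d : ℕ} (u : TestFun d) : Continuous (∇ (u : Ambient d → ℝ)) :=
  (InnerProductSpace.toDual ℝ (Ambient d)).symm.continuous.comp
    (u.contDiff.continuous_fderiv (by simp))

theorem TestFun.integrable_inner_gradient {d : ℕ} (u v : TestFun d) :
    Integrable (fun x => inner ℝ (∇ u x) (∇ v x)) (volume.restrict (halfSpace d)) := by
  refine Integrable.restrict (Continuous.integrable_of_hasCompactSupport
    (u.continuous_gradient.inner v.continuous_gradient) ?_)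
  refine (u.hasCompactSupport.fderiv (𝕜 := ℝ)).mono ?_
  intro x hx hx'
  apply hx
  simp [gradient, hx']

/-- The form `(u, v) ↦ ∫_{ℝ^N_+} ∇u · ∇v`. -/
@[reducible]
def dirichletCore (d : ℕ) : PreInnerProductSpace.Core ℝ (TestFun d) where
  inner u v := ∫ x in halfSpace d, inner ℝ (∇ u x) (∇ v x)
  conj_inner_symm u v := by
    simp only [conj_trivial]
    exact integral_congr_ae (Filter.Eventually.of_forall fun x => real_inner_comm _ _)
  re_inner_nonneg u := integral_nonneg fun x => real_inner_self_nonneg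
  add_left u v w := by
    simp only [TestFun.gradient_add, inner_add_left]
    exact integral_add (u.integrable_inner_gradient w) (v.integrable_inner_gradient w)
  smul_left u v c := by
    simp only [TestFun.gradient_smul, real_inner_smul_left]
    exact integral_const_mul c _

instance (d : ℕ) : SeminormedAddCommGroup (TestFun d) :=
  @InnerProductSpace.Core.toSeminormedAddCommGroup ℝ (TestFun d) _ _ _ (dirichletCore d)

instance (d : ℕ) : InnerProductSpace ℝ (TestFun d) := InnerProductSpace.ofCore (dirichletCore d)

/-- The norm on test functions is the `L²(ℝ^N_+)`-norm of the gradient. -/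
theorem TestFun.norm_sq {d : ℕ} (u : TestFun d) :
    ‖u‖ ^ 2 = ∫ x in halfSpace d, ‖∇ u x‖ ^ 2 := by
  rw [← real_inner_self_eq_norm_sq]
  simp only [← real_inner_self_eq_norm_sq]
  rfl

/-- The Beppo Levi space `D^{1,2}` of the closed half-space: the completion of `C_c^∞` with respect
to the `L²(ℝ^N_+)`-norm of the gradient. For `u : D12 d` the number `∫_{ℝ^N_+} |∇u|²` is `‖u‖ ^ 2`. -/
abbrev D12 (d : ℕ) : Type := UniformSpace.Completion (TestFun d)

/-- `C_c^∞` of the closed half-space minus `K`: the test functions that vanish on a relative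
neighbourhood of `K` in the closed half-space. -/
def testFunOff {d : ℕ} (K : Set (Ambient d)) : Submodule ℝ (TestFun d) where
  carrier := {u | ∃ U : Set (Ambient d), IsOpen U ∧ K ⊆ U ∧
    ∀ x ∈ U ∩ closure (halfSpace d), u x = 0}
  add_mem' := by
    rintro u v ⟨U, hU, hKU, hu⟩ ⟨V, hV, hKV, hv⟩
    refine ⟨U ∩ V, hU.inter hV, subset_inter hKU hKV, fun x hx => ?_⟩
    rw [TestFun.add_apply, hu x ⟨hx.1.1, hx.2⟩, hv x ⟨hx.1.2, hx.2⟩, add_zero]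
  zero_mem' := ⟨univ, isOpen_univ, subset_univ K, fun _ _ => rfl⟩
  smul_mem' := by
    rintro c u ⟨U, hU, hKU, hu⟩
    exact ⟨U, hU, hKU, fun x hx => by rw [TestFun.smul_apply, hu x hx, mul_zero]⟩

/-- The space `D^{1,2}` of the closed half-space minus `K`: the closure in `D12 d` of the test
functions that vanish near `K`. -/
def D12Off {d : ℕ} (K : Set (Ambient d)) : Submodule ℝ (D12 d) :=
  ((testFunOff K).map
    (UniformSpace.Completion.toComplₗᵢ : TestFun d →ₗᵢ[ℝ] D12 d).toLinearMap).topologicalClosure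

/-- The relative `f`-capacity of `K` in the closed half-space. -/
def relCapacityOf {d : ℕ} (K : Set (Ambient d)) (f : D12 d) : ℝ :=
  sInf {t : ℝ | ∃ u : D12 d, u - f ∈ D12Off K ∧ t = ‖u‖ ^ 2}

/-- `η` is equal to `1` in a neighbourhood of `K` (relative to the closed half-space). -/
def IsCutoff {d : ℕ} (K : Set (Ambient d)) (η : TestFun d) : Prop :=
  ∃ U : Set (Ambient d), IsOpen U ∧ K ⊆ U ∧ ∀ x ∈ U ∩ closure (halfSpace d), η x = 1

/-- The relative capacity of `K` in the closed half-space: the relative `η`-capacity, where `η` is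
equal to `1` near `K`. By `relCapacity_eq` all such `η` give the same value. -/
def relCapacity {d : ℕ} (K : Set (Ambient d)) : ℝ :=
  ⨅ η : {η : TestFun d // IsCutoff K η}, relCapacityOf K (η.1 : D12 d)

theorem relCapacityOf_congr {d : ℕ} {K : Set (Ambient d)} {η θ : TestFun d}
    (hη : IsCutoff K η) (hθ : IsCutoff K θ) :
    relCapacityOf K (η : D12 d) = relCapacityOf K (θ : D12 d) := by
  have hmem : (η : D12 d) - (θ : D12 d) ∈ D12Off K := by
    obtain ⟨U, hU, hKU, hu⟩ := hη
    obtain ⟨V, hV, hKV, hv⟩ := hθ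
    refine Submodule.le_topologicalClosure _ ⟨η - θ, ⟨U ∩ V, hU.inter hV,
      subset_inter hKU hKV, fun x hx => ?_⟩, UniformSpace.Completion.coe_sub η θ⟩
    rw [TestFun.sub_apply, hu x ⟨hx.1.1, hx.2⟩, hv x ⟨hx.1.2, hx.2⟩, sub_self]
  have key : ∀ u : D12 d, u - (η : D12 d) ∈ D12Off K ↔ u - (θ : D12 d) ∈ D12Off K := by
    intro u
    rw [← sub_add_sub_cancel u (η : D12 d) (θ : D12 d)]
    exact ((D12Off K).add_mem_iff_left hmem).symm
  simp only [relCapacityOf, key]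

theorem relCapacity_eq {d : ℕ} {K : Set (Ambient d)} {η : TestFun d} (hη : IsCutoff K η) :
    relCapacity K = relCapacityOf K (η : D12 d) := by
  have : Nonempty {η : TestFun d // IsCutoff K η} := ⟨⟨η, hη⟩⟩
  have h : ∀ θ : {θ : TestFun d // IsCutoff K θ},
      relCapacityOf K (θ.1 : D12 d) = relCapacityOf K (η : D12 d) :=
    fun θ => relCapacityOf_congr θ.2 hη
  simp only [relCapacity, h, ciInf_const]

end

end HalfSpaceCapacity

namespace HalfSpaceCapacity

open MeasureTheory Set Filter
open scoped Gradient ENNReal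

/-! Write d = N - 1 and p = 2d/(d - 1), and let u be a test function equal to 1 on K. Set v = |u|^p,
I = ∫ |∇v| and D = ∫ |∇u|², over the half-space. Integrating ∂_N v along vertical rays from K, where
v = 1, gives |K| ≤ I (`volume_boundary_le_lintegral_fderiv`). Since |∇v| ≤ p |u|^(p-1) |∇u|,
Cauchy-Schwarz bounds I by p (∫ |u|^(2(p-1)))^(1/2) D^(1/2). The choice of p makes |u|^(2(p-1)) =
v^((d+1)/d), so the L¹ Sobolev inequality bounds the first integral by I^((d+1)/d). Absorbing the
power of I leaves I^((d-1)/d) ≤ p² D (`lintegral_fderiv_rpow_le`), whence C = p². Density carries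
the bound from test functions to the capacity (`le_relCapacity`). -/

/-- The sides of the half-space, viewed as a product of intervals. -/
def halfSpaceSide (d : ℕ) (i : Fin (d + 1)) : Set ℝ := if i = Fin.last d then Ioi 0 else univ

/-- Lebesgue measure on the sides of the half-space. -/
noncomputable def sideMeasure (d : ℕ) (i : Fin (d + 1)) : Measure ℝ :=
  volume.restrict (halfSpaceSide d i)

instance (d : ℕ) (i : Fin (d + 1)) : SigmaFinite (sideMeasure d i) := by
  unfold sideMeasure; infer_instance

theorem measurableSet_halfSpaceSide (d : ℕ) (i : Fin (d + 1)) :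
    MeasurableSet (halfSpaceSide d i) := by
  unfold halfSpaceSide; split_ifs <;> measurability

theorem preimage_toLp_halfSpace (d : ℕ) :
    (WithLp.toLp 2 : (Fin (d + 1) → ℝ) → Ambient d) ⁻¹' halfSpace d
      = univ.pi (halfSpaceSide d) := by
  ext x
  simp only [halfSpace, halfSpaceSide, mem_preimage, mem_ofPred_eq, mem_univ_pi]
  constructor
  · intro h i
    split_ifs with hi
    · subst hi; exact h
    · trivial
  · intro h
    simpa using h (Fin.last d)

theorem pi_sideMeasure (d : ℕ) :
    Measure.pi (sideMeasure d) = volume.restrict (univ.pi (halfSpaceSide d)) := by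
  rw [volume_pi, Measure.restrict_pi_pi]; rfl

theorem setLIntegral_halfSpace (d : ℕ) (g : Ambient d → ℝ≥0∞) :
    ∫⁻ x in halfSpace d, g x = ∫⁻ x, g (WithLp.toLp 2 x) ∂Measure.pi (sideMeasure d) := by
  rw [pi_sideMeasure, ← preimage_toLp_halfSpace]
  exact ((PiLp.volume_preserving_toLp (Fin (d + 1))).setLIntegral_comp_preimage_emb
    (MeasurableEquiv.toLp 2 (Fin (d + 1) → ℝ)).measurableEmbedding g _).symm

/-! ### The L¹ Sobolev inequality on the half-space -/

/-- A compactly supported `C¹` function is controlled by the integral of its derivative along a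
half-line parallel to a coordinate axis. -/
theorem enorm_le_lintegral_Ioi_fderiv_update {d : ℕ} {v : Ambient d → ℝ} (hv : ContDiff ℝ 1 v)
    (hc : HasCompactSupport v) (x : Fin (d + 1) → ℝ) (i : Fin (d + 1)) :
    ‖v (WithLp.toLp 2 x)‖ₑ ≤
      ∫⁻ t in Ioi (x i), ‖fderiv ℝ v (WithLp.toLp 2 (Function.update x i t))‖ₑ := by
  let L : ℝ → Ambient d := fun t => WithLp.toLp 2 (Function.update x i t)
  have hL (t : ℝ) : HasDerivAt L (EuclideanSpace.single i 1) t := by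
    have := (PiLp.continuousLinearEquiv 2 ℝ (fun _ : Fin (d + 1) => ℝ)).symm.hasFDerivAt
      (x := Function.update x i t) |>.comp_hasDerivAt t (hasDerivAt_update x i t)
    exact this
  have hLc : ContDiff ℝ 1 L :=
    (PiLp.continuousLinearEquiv 2 ℝ (fun _ : Fin (d + 1) => ℝ)).symm.contDiff.comp
      (contDiff_update 1 x i)
  have hLe : Topology.IsClosedEmbedding L :=
    (PiLp.homeomorph 2 (fun _ : Fin (d + 1) => ℝ)).symm.isClosedEmbedding.comp
      (isClosedEmbedding_update x i)
  have h1 : ContDiff ℝ 1 (v ∘ L) := hv.comp hLc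
  have h2 : HasCompactSupport (v ∘ L) := hc.comp_isClosedEmbedding hLe
  have h3 := h2.integral_Ioi_deriv_eq h1 (x i)
  have h4 : v (WithLp.toLp 2 x) = (v ∘ L) (x i) := by simp [L]
  rw [h4, ← enorm_neg, ← h3]
  refine (enorm_integral_le_lintegral_enorm _).trans (lintegral_mono fun t => ?_)
  have h5 : deriv (v ∘ L) t = fderiv ℝ v (L t) (EuclideanSpace.single i 1) :=
    ((hv.differentiable one_ne_zero (L t)).hasFDerivAt.comp_hasDerivAt t (hL t)).deriv
  rw [h5]
  refine (ContinuousLinearMap.le_opENorm _ _).trans ?_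
  have : ‖(EuclideanSpace.single i (1 : ℝ) : Ambient d)‖ₑ = 1 := by
    rw [← ofReal_norm]; simp
  rw [this, mul_one]

/-- The Gagliardo-Nirenberg-Sobolev inequality on the half-space, for `p = 1`. -/
theorem lintegral_pow_le_pow_lintegral_fderiv_halfSpace {d : ℕ} (hd : 1 ≤ d)
    {v : Ambient d → ℝ} (hv : ContDiff ℝ 1 v) (hc : HasCompactSupport v) :
    ∫⁻ x in halfSpace d, ‖v x‖ₑ ^ (((d : ℝ) + 1) / d) ≤
      (∫⁻ x in halfSpace d, ‖fderiv ℝ v x‖ₑ) ^ (((d : ℝ) + 1) / d) := by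
  have hd' : (0 : ℝ) < d := by exact_mod_cast hd
  have hp : Real.HolderConjugate (Fintype.card (Fin (d + 1)) : ℝ) (((d : ℝ) + 1) / d) := by
    rw [Real.holderConjugate_iff]
    simp only [Fintype.card_fin]
    push_cast
    constructor
    · linarith
    · field_simp; ring
  have hf : Measurable fun x : Fin (d + 1) → ℝ => ‖fderiv ℝ v (WithLp.toLp 2 x)‖ₑ := by
    have := hv.continuous_fderiv one_ne_zero
    have h2 : Continuous fun x : Fin (d + 1) → ℝ => ‖fderiv ℝ v (WithLp.toLp 2 x)‖ₑ := by
      fun_prop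
    exact h2.measurable
  rw [setLIntegral_halfSpace, setLIntegral_halfSpace]
  -- The grid-lines inequality holds for any product of σ-finite measures, hence for Lebesgue
  -- measure restricted to the sides; no extension across the boundary is needed.
  refine le_trans ?_ (lintegral_prod_lintegral_pow_le (sideMeasure d) hp hf)
  have hae : ∀ᵐ x ∂Measure.pi (sideMeasure d), x ∈ univ.pi (halfSpaceSide d) := by
    rw [pi_sideMeasure]
    exact ae_restrict_mem (MeasurableSet.univ_pi (measurableSet_halfSpaceSide d))
  refine lintegral_mono_ae ?_
  filter_upwards [hae] with x hx
  have key (i : Fin (d + 1)) : ‖v (WithLp.toLp 2 x)‖ₑ ≤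
      ∫⁻ t, ‖fderiv ℝ v (WithLp.toLp 2 (Function.update x i t))‖ₑ ∂sideMeasure d i := by
    refine (enorm_le_lintegral_Ioi_fderiv_update hv hc x i).trans ?_
    -- Rays in the positive coordinate directions never leave the half-space.
    refine lintegral_mono_set fun t ht => ?_
    have := hx i (mem_univ i)
    unfold halfSpaceSide at this ⊢
    split_ifs at this ⊢
    · exact lt_trans (mem_Ioi.1 this) (mem_Ioi.1 ht)
    · trivial
  -- The power (d+1)/d is split into d+1 factors of exponent 1/d, one for each axis.
  calc ‖v (WithLp.toLp 2 x)‖ₑ ^ (((d : ℝ) + 1) / d)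
      = ∏ _i : Fin (d + 1), ‖v (WithLp.toLp 2 x)‖ₑ ^
          ((1 : ℝ) / ((Fintype.card (Fin (d + 1)) : ℝ) - 1)) := by
        rw [Finset.prod_const, ← ENNReal.rpow_natCast, ← ENNReal.rpow_mul]
        congr 1
        simp
        field_simp
    _ ≤ _ := by
        refine Finset.prod_le_prod' fun i _ => ENNReal.rpow_le_rpow (key i) ?_
        simp

/-! ### The trace estimate -/

/-- Inclusion of the boundary hyperplane. -/
noncomputable def boundaryPoint {d : ℕ} (y : EuclideanSpace ℝ (Fin d)) : Ambient d :=
  WithLp.toLp 2 (Fin.snoc (α := fun _ => ℝ) (fun i => y i) 0)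

/-- A weak-type `L¹` trace inequality on the half-space. -/
theorem volume_boundary_le_lintegral_fderiv {d : ℕ} {v : Ambient d → ℝ} (hv : ContDiff ℝ 1 v)
    (hc : HasCompactSupport v) {S : Set (EuclideanSpace ℝ (Fin d))}
    (hS : ∀ y ∈ S, 1 ≤ ‖v (boundaryPoint y)‖ₑ) :
    volume S ≤ ∫⁻ x in halfSpace d, ‖fderiv ℝ v x‖ₑ := by
  have hcont := hv.continuous_fderiv one_ne_zero
  have hmeas : Measurable fun q : ℝ × (Fin d → ℝ) =>
      ‖fderiv ℝ v (WithLp.toLp 2 (Fin.snoc (α := fun _ => ℝ) q.2 q.1))‖ₑ := by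
    have h : Continuous fun q : ℝ × (Fin d → ℝ) =>
        ‖fderiv ℝ v (WithLp.toLp 2 (Fin.snoc (α := fun _ => ℝ) q.2 q.1))‖ₑ := by
      have : Continuous fun q : ℝ × (Fin d → ℝ) => Fin.snoc (α := fun _ => ℝ) q.2 q.1 :=
        Continuous.finSnoc continuous_snd continuous_fst
      fun_prop
    exact h.measurable
  have hsplit : ∫⁻ x in halfSpace d, ‖fderiv ℝ v x‖ₑ = ∫⁻ y : Fin d → ℝ, ∫⁻ t in Ioi (0 : ℝ),
      ‖fderiv ℝ v (WithLp.toLp 2 (Fin.snoc (α := fun _ => ℝ) y t))‖ₑ := by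
    rw [setLIntegral_halfSpace, ← (measurePreserving_piFinSuccAbove (sideMeasure d)
      (Fin.last d)).symm.lintegral_comp_emb (MeasurableEquiv.measurableEmbedding _)]
    have h1 : sideMeasure d (Fin.last d) = volume.restrict (Ioi 0) := by
      simp [sideMeasure, halfSpaceSide]
    have h2 : (Measure.pi fun j : Fin d => sideMeasure d ((Fin.last d).succAbove j))
        = volume := by
      rw [volume_pi]
      congr 1
      ext1 j
      simp [sideMeasure, halfSpaceSide, (Fin.castSucc_lt_last j).ne]
    rw [h1, h2]
    rw [← lintegral_prod_symm _ hmeas.aemeasurable]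
    refine lintegral_congr fun q => ?_
    simp [MeasurableEquiv.piFinSuccAbove_symm_apply, Fin.insertNthEquiv, Fin.insertNth_last']
  rw [hsplit, ← (PiLp.volume_preserving_ofLp (Fin d)).lintegral_comp hmeas.lintegral_prod_left']
  calc volume S ≤ volume {y : EuclideanSpace ℝ (Fin d) | 1 ≤ ∫⁻ t in Ioi (0 : ℝ),
      ‖fderiv ℝ v (WithLp.toLp 2 (Fin.snoc (α := fun _ => ℝ) (WithLp.ofLp y) t))‖ₑ} := by
        refine measure_mono fun y hy => (hS y hy).trans ?_
        have := enorm_le_lintegral_Ioi_fderiv_update hv hc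
          (Fin.snoc (α := fun _ => ℝ) (fun i => y i) 0) (Fin.last d)
        simp only [Fin.snoc_last, Fin.update_snoc_last] at this
        exact this
    _ ≤ _ := by
        -- Markov's inequality at level 1.
        simpa using meas_ge_le_lintegral_div
          (hmeas.lintegral_prod_left'.comp
            (PiLp.volume_preserving_ofLp (Fin d)).measurable).aemeasurable one_ne_zero
          ENNReal.one_ne_top

/-- Finiteness is what permits cancelling a power of this integral in the absorption step. -/
theorem lintegral_fderiv_lt_top {d : ℕ} {v : Ambient d → ℝ} (hv : ContDiff ℝ 1 v)
    (hc : HasCompactSupport v) : ∫⁻ x in halfSpace d, ‖fderiv ℝ v x‖ₑ < ∞ :=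
  ((hv.continuous_fderiv one_ne_zero).integrable_of_hasCompactSupport
    (hc.fderiv (𝕜 := ℝ))).restrict.2

/-! ### Absorption and the bound for test functions -/

/-- The trace exponent `2 (N - 1) / (N - 2)` for `N = d + 1`. -/
noncomputable def traceExponent (d : ℕ) : ℝ := 2 * d / (d - 1)

/-- Sobolev's inequality in terms of the gradient of the power `|u| ^ (2 (N - 1) / (N - 2))`. -/
theorem lintegral_fderiv_rpow_le {d : ℕ} (hd : 2 ≤ d) {u : Ambient d → ℝ} (hu : ContDiff ℝ 1 u)
    (hc : HasCompactSupport u) :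
    (∫⁻ x in halfSpace d, ‖fderiv ℝ (fun x => ‖u x‖ ^ traceExponent d) x‖ₑ) ^
        (((d : ℝ) - 1) / d) ≤
      ENNReal.ofReal (traceExponent d) ^ (2 : ℝ) *
        ∫⁻ x in halfSpace d, ‖fderiv ℝ u x‖ₑ ^ (2 : ℝ) := by
  have hd2 : (2 : ℝ) ≤ d := by exact_mod_cast hd
  have hd1 : (0 : ℝ) < (d : ℝ) - 1 := by linarith
  have hd0 : (0 : ℝ) < d := by linarith
  set p := traceExponent d with hp
  have hp1 : 1 < p := by
    rw [hp, traceExponent, lt_div_iff₀ hd1]; linarith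
  have hp0 : 0 ≤ p := by linarith
  set v : Ambient d → ℝ := fun x => ‖u x‖ ^ p with hvdef
  have hv : ContDiff ℝ 1 v := hu.norm_rpow hp1
  have hvc : HasCompactSupport v :=
    hc.comp_left (g := fun s : ℝ => ‖s‖ ^ p) (by simp [Real.zero_rpow (zero_lt_one.trans hp1).ne'])
  set I := ∫⁻ x in halfSpace d, ‖fderiv ℝ v x‖ₑ with hI
  set D := ∫⁻ x in halfSpace d, ‖fderiv ℝ u x‖ₑ ^ (2 : ℝ) with hD
  have hItop : I ≠ ∞ := (lintegral_fderiv_lt_top hv hvc).ne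
  have hucont := hu.continuous
  have hu'cont := hu.continuous_fderiv one_ne_zero
  have hsob := lintegral_pow_le_pow_lintegral_fderiv_halfSpace (by omega : 1 ≤ d) hv hvc
  -- The identity p(d+1)/d = 2(p-1), which singles out p.
  have hvu (x) : ‖v x‖ₑ ^ (((d : ℝ) + 1) / d) = (‖u x‖ₑ ^ (p - 1)) ^ (2 : ℝ) := by
    have : ‖v x‖ₑ = ‖u x‖ₑ ^ p := by
      rw [hvdef]
      simp only
      rw [← ofReal_norm, Real.norm_of_nonneg (by positivity),
        ← ENNReal.ofReal_rpow_of_nonneg (norm_nonneg _) hp0, ofReal_norm]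
    rw [this, ← ENNReal.rpow_mul, ← ENNReal.rpow_mul]
    congr 1
    rw [hp, traceExponent]
    field_simp
    ring
  have hhol : I ≤ ENNReal.ofReal p * (I ^ (((d : ℝ) + 1) / (2 * d)) * D ^ (1 / 2 : ℝ)) := by
    calc I ≤ ∫⁻ x in halfSpace d, ENNReal.ofReal p * (‖u x‖ₑ ^ (p - 1) * ‖fderiv ℝ u x‖ₑ) := by
          refine lintegral_mono fun x => ?_
          have := enorm_fderiv_norm_rpow_le (hu.differentiable one_ne_zero) (x := x)
            (p := p.toNNReal) (by simpa using hp1)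
          rw [Real.coe_toNNReal _ hp0] at this
          rw [mul_assoc] at this
          exact this
      _ = ENNReal.ofReal p * ∫⁻ x in halfSpace d, ‖u x‖ₑ ^ (p - 1) * ‖fderiv ℝ u x‖ₑ :=
          lintegral_const_mul' _ _ ENNReal.ofReal_ne_top
      _ ≤ ENNReal.ofReal p * ((∫⁻ x in halfSpace d, (‖u x‖ₑ ^ (p - 1)) ^ (2 : ℝ)) ^ (1 / 2 : ℝ)
            * D ^ (1 / 2 : ℝ)) := by
          gcongr
          exact ENNReal.lintegral_mul_le_Lp_mul_Lq _ Real.HolderConjugate.two_two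
            (hucont.measurable.enorm.pow_const _).aemeasurable
            hu'cont.measurable.enorm.aemeasurable
      _ ≤ _ := by
          gcongr
          simp only [← hvu]
          refine (ENNReal.rpow_le_rpow hsob (by norm_num)).trans_eq ?_
          rw [← ENNReal.rpow_mul]
          congr 1
          field_simp
  rcases eq_or_ne I 0 with h0 | h0
  · rw [h0, ENNReal.zero_rpow_of_pos (by positivity)]
    exact zero_le
  -- The exponents (d-1)/(2d) and (d+1)/(2d) add up to 1; the second factor is the one cancelled
  -- from `hhol`.
  have ha : I = I ^ (((d : ℝ) - 1) / (2 * d)) * I ^ (((d : ℝ) + 1) / (2 * d)) := by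
    rw [← ENNReal.rpow_add _ _ h0 hItop, ← add_div]
    have : ((d : ℝ) - 1 + (d + 1)) / (2 * d) = 1 := by field_simp; ring
    rw [this, ENNReal.rpow_one]
  have hb0 : I ^ (((d : ℝ) + 1) / (2 * d)) ≠ 0 := by
    simp only [ne_eq, ENNReal.rpow_eq_zero_iff, h0, hItop, false_and, or_self, not_false_iff]
  have hbt : I ^ (((d : ℝ) + 1) / (2 * d)) ≠ ∞ :=
    ENNReal.rpow_ne_top_of_nonneg (by positivity) hItop
  have hroot : I ^ (((d : ℝ) - 1) / (2 * d)) ≤ ENNReal.ofReal p * D ^ (1 / 2 : ℝ) := by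
    rw [← ENNReal.mul_le_mul_iff_left hb0 hbt, ← ha]
    refine hhol.trans_eq ?_
    ring
  have := ENNReal.rpow_le_rpow hroot (by norm_num : (0 : ℝ) ≤ 2)
  rw [ENNReal.mul_rpow_of_nonneg _ _ (by norm_num), ← ENNReal.rpow_mul, ← ENNReal.rpow_mul] at this
  have e1 : ((d : ℝ) - 1) / (2 * d) * 2 = (d - 1) / d := by field_simp
  rw [e1] at this
  simpa using this

/-- The capacitary inequality for test functions that are equal to `1` on `K`. -/
theorem boundaryMeasure_rpow_le_norm_sq {d : ℕ} (hd : 2 ≤ d) {K : Set (Ambient d)} (u : TestFun d)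
    (hu : ∀ x ∈ K, u x = 1) :
    boundaryMeasure K ^ (((d : ℝ) - 1) / d) ≤ traceExponent d ^ 2 * ‖u‖ ^ 2 := by
  have hd2 : (2 : ℝ) ≤ d := by exact_mod_cast hd
  have hd1 : (0 : ℝ) < (d : ℝ) - 1 := by linarith
  have hp1 : 1 < traceExponent d := by
    rw [traceExponent, lt_div_iff₀ hd1]; linarith
  have hu1 : ContDiff ℝ 1 u := u.contDiff.of_le (by simp)
  have hvol : volume {y : EuclideanSpace ℝ (Fin d) | boundaryPoint y ∈ K} ≤
      ∫⁻ x in halfSpace d, ‖fderiv ℝ (fun x => ‖u x‖ ^ traceExponent d) x‖ₑ := by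
    refine volume_boundary_le_lintegral_fderiv (hu1.norm_rpow hp1)
      (u.hasCompactSupport.comp_left (g := fun s : ℝ => ‖s‖ ^ traceExponent d)
        (by simp [Real.zero_rpow (zero_lt_one.trans hp1).ne'])) fun y hy => ?_
    simp [hu _ hy]
  have hmain := (ENNReal.rpow_le_rpow hvol (by positivity : 0 ≤ ((d : ℝ) - 1) / d)).trans
    (lintegral_fderiv_rpow_le hd hu1 u.hasCompactSupport)
  have hD : ∫⁻ x in halfSpace d, ‖fderiv ℝ u x‖ₑ ^ (2 : ℝ) = ENNReal.ofReal (‖u‖ ^ 2) := by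
    rw [TestFun.norm_sq, ofReal_integral_eq_lintegral_ofReal]
    · refine lintegral_congr fun x => ?_
      rw [ENNReal.ofReal_pow (norm_nonneg _), ofReal_norm, ← ENNReal.rpow_natCast]
      have : ‖∇ u x‖ₑ = ‖fderiv ℝ u x‖ₑ := by
        rw [← ofReal_norm, ← ofReal_norm, gradient, LinearIsometryEquiv.norm_map]
      rw [this]; norm_num
    · simpa only [real_inner_self_eq_norm_sq] using u.integrable_inner_gradient u
    · exact Eventually.of_forall fun x => by positivity
  rw [hD] at hmain
  have hfin : ENNReal.ofReal (traceExponent d) ^ (2 : ℝ) * ENNReal.ofReal (‖u‖ ^ 2) ≠ ∞ :=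
    ENNReal.mul_ne_top (ENNReal.rpow_ne_top_of_nonneg (by norm_num) ENNReal.ofReal_ne_top)
      ENNReal.ofReal_ne_top
  have := ENNReal.toReal_mono hfin hmain
  rw [ENNReal.toReal_mul, ← ENNReal.toReal_rpow, ← ENNReal.toReal_rpow,
    ENNReal.toReal_ofReal (by linarith), ENNReal.toReal_ofReal (by positivity),
    Real.rpow_two] at this
  exact this

/-! ### From test functions to the capacity -/

theorem exists_isCutoff {d : ℕ} {K : Set (Ambient d)} (hK : IsCompact K) :
    ∃ η : TestFun d, IsCutoff K η := by
  obtain ⟨R, hR, hKR⟩ := hK.isBounded.subset_ball_lt 0 0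
  let f : ContDiffBump (0 : Ambient d) := ⟨R, R + 1, hR, by linarith⟩
  exact ⟨⟨f, f.contDiff, f.hasCompactSupport⟩, Metric.ball 0 R, Metric.isOpen_ball, hKR,
    fun x hx => f.one_of_mem_closedBall (Metric.ball_subset_closedBall hx.1)⟩

/-- A lower bound for the norm of the test functions equal to `1` near `K` is a lower bound for the
capacity of `K`. -/
theorem le_relCapacity {d : ℕ} {K : Set (Ambient d)} (hK : IsCompact K) {c : ℝ}
    (h : ∀ u : TestFun d, IsCutoff K u → c ≤ ‖u‖ ^ 2) : c ≤ relCapacity K := by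
  obtain ⟨η, hη⟩ := exists_isCutoff hK
  rw [relCapacity_eq hη]
  refine le_csInf ⟨_, (η : D12 d), by simp, rfl⟩ ?_
  rintro _ ⟨u, hu, rfl⟩
  -- The bound is a closed condition on w = u - η, so it suffices to check it for test functions w
  -- vanishing near K; then w + η is again a cutoff.
  have hclosed : IsClosed {w : D12 d | c ≤ ‖w + (η : D12 d)‖ ^ 2} :=
    isClosed_le continuous_const (by fun_prop)
  have hsub : closure ((testFunOff K).map
      (UniformSpace.Completion.toComplₗᵢ : TestFun d →ₗᵢ[ℝ] D12 d).toLinearMap : Set (D12 d)) ⊆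
      {w : D12 d | c ≤ ‖w + (η : D12 d)‖ ^ 2} := by
    refine hclosed.closure_subset_iff.2 ?_
    rintro _ ⟨w, ⟨V, hV, hKV, hw⟩, rfl⟩
    obtain ⟨U, hU, hKU, hη1⟩ := hη
    have hcut : IsCutoff K (w + η) := ⟨U ∩ V, hU.inter hV, subset_inter hKU hKV, fun x hx => by
      rw [TestFun.add_apply, hw x ⟨hx.1.2, hx.2⟩, hη1 x ⟨hx.1.1, hx.2⟩, zero_add]⟩
    have := h _ hcut
    rw [← UniformSpace.Completion.norm_coe, UniformSpace.Completion.coe_add] at this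
    exact this
  have := hsub hu
  simpa using this

end HalfSpaceCapacity

theorem mainTheorem9 (d : ℕ) (hd : 3 ≤ d + 1) :
    ∃ C : ℝ, 0 < C ∧ ∀ K : Set (HalfSpaceCapacity.Ambient d), IsCompact K →
      K ⊆ frontier (HalfSpaceCapacity.halfSpace d) →
      HalfSpaceCapacity.boundaryMeasure K ^ ((((d + 1 : ℕ) : ℝ) - 2) / (((d + 1 : ℕ) : ℝ) - 1)) ≤
        C * HalfSpaceCapacity.relCapacity K := by
  open HalfSpaceCapacity in
  have hd2 : (2 : ℝ) ≤ d := by exact_mod_cast (by omega : 2 ≤ d)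
  have hC : 0 < traceExponent d ^ 2 := by
    have : 0 < traceExponent d := div_pos (by linarith) (by linarith)
    positivity
  refine ⟨traceExponent d ^ 2, hC, fun K hK hKf => ?_⟩
  have he : (((d + 1 : ℕ) : ℝ) - 2) / (((d + 1 : ℕ) : ℝ) - 1) = ((d : ℝ) - 1) / d := by
    push_cast; congr 1 <;> ring
  rw [he, ← div_le_iff₀' hC]
  refine le_relCapacity hK fun u hu => ?_
  rw [div_le_iff₀' hC]
  obtain ⟨U, -, hKU, hu1⟩ := hu
  exact boundaryMeasure_rpow_le_norm_sq (by omega) u fun x hx =>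
    hu1 x ⟨hKU hx, frontier_subset_closure (hKf hx)⟩
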